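/- Let $|\psi\rangle=\sum_{a,b,c\in\{0,1\}}\psi_{abc}|abc\rangle\in\mathbb C^2\otimes\mathbb C^2\otimes\mathbb C^2$ be a normalized pure state of three qubits $A,B,C$, and let $\rho_{AB},\rho_{AC},\rho_{BC},\rho_A,\rho_B$ be its reduced density matrices. Put $$\phi_{ABC}=69-\mathrm{Tr}\big[(2\rho_{AB}+\rho_A\otimes I_B+I_A\otimes\rho_B)^3\big]-3\,\mathrm{Tr}(\rho_{AB}^2),\qquad I_5=\mathrm{Tr}\big[(\rho_{BC}^{\Gamma})^3\big],$$ where $\Gamma$ is the partial transpose on the second qubit of the pair. For a two-qubit pure state $\varphi$ let $\tau(\varphi)=2\big(1-\mathrm{Tr}(\sigma^2)\big)$, with $\sigma$ the reduced density matrix of the first qubit. For a two-qubit density matrix $\rho$ let $\tau(\rho)=\inf\sum_\ell p_\ell\,\tau(\varphi_\ell)$ be its convex roof, where the infimum is over all finite decompositions $\rho=\sum_\ell p_\ell|\varphi_\ell\rangle\langle\varphi_\ell|$ with $p_\ell\ge 0$, $\sum_\ell p_\ell=1$ and normalized $\varphi_\ell$. Put $\tau_{A|B}=\tau(\rho_{AB})$,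 $\tau_{A|C}=\tau(\rho_{AC})$, $\tau_{B|C}=\tau(\rho_{BC})$, $\tau_{A|BC}=2\big(1-\mathrm{Tr}(\rho_A^2)\big)$ and $\tau_{ABC}=\tau_{A|BC}-\tau_{A|B}-\tau_{A|C}$ (the three-tangle). Then $$\phi_{ABC}=12(1-I_5)+27\big(\tau_{A|B}+\tau_{A|C}+\tau_{B|C}\big)+\frac{81}{2}\,\tau_{ABC}.$$ Moreover, each of $I_5$, $\tau_{A|B}+\tau_{A|C}+\tau_{B|C}$ and $\tau_{ABC}$, and hence $\phi_{ABC}$, is unchanged when the three qubits of $\psi$ are permuted in any way. -/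

import Mathlib

open scoped Kronecker ComplexOrder

namespace ThreeQubit

/-- The Hilbert space with orthonormal basis indexed by `ι`. -/
abbrev Ket (ι : Type) [Fintype ι] : Type := EuclideanSpace ℂ ι

/-- The operator `|ψ⟩⟨ψ|`. -/
def proj {ι : Type} [Fintype ι] (ψ : Ket ι) : Matrix ι ι ℂ :=
  Matrix.of fun i j => ψ i * star (ψ j)

/-- Partial trace over the second tensor factor. -/
def traceSnd {α β : Type} [Fintype β] (M : Matrix (α × β) (α × β) ℂ) : Matrix α α ℂ :=
  Matrix.of fun a a' => ∑ b, M (a, b) (a', b)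

/-- Partial trace over the first tensor factor. -/
def traceFst {α β : Type} [Fintype α] (M : Matrix (α × β) (α × β) ℂ) : Matrix β β ℂ :=
  Matrix.of fun b b' => ∑ a, M (a, b) (a, b')

/-- Partial transpose with respect to the second tensor factor. -/
def partialTranspose {α β : Type} (M : Matrix (α × β) (α × β) ℂ) :
    Matrix (α × β) (α × β) ℂ :=
  Matrix.of fun p q => M (p.1, q.2) (q.1, p.2)

/-- The pair of weights `p` and vectors `φ` is a convex decomposition of `ρ` into
(normalized) pure states. -/
structure IsPureDecomposition {ι : Type} [Fintype ι] (ρ : Matrix ι ι ℂ) {n : ℕ}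
    (p : Fin n → ℝ) (φ : Fin n → Ket ι) : Prop where
  nonneg : ∀ l, 0 ≤ p l
  sum_eq_one : ∑ l, p l = 1
  norm_eq_one : ∀ l, ‖φ l‖ = 1
  sum_proj : ∑ l, (p l : ℂ) • proj (φ l) = ρ

/-- The averages `∑ l, p l * f (φ l)` over all pure state decompositions of `ρ`. -/
def roofValues {ι : Type} [Fintype ι] (f : Ket ι → ℝ) (ρ : Matrix ι ι ℂ) : Set ℝ :=
  {r | ∃ (n : ℕ) (p : Fin n → ℝ) (φ : Fin n → Ket ι),
    IsPureDecomposition ρ p φ ∧ r = ∑ l, p l * f (φ l)}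

/-- Convex-roof extension of a function on pure states. -/
noncomputable def convexRoof {ι : Type} [Fintype ι] (f : Ket ι → ℝ) (ρ : Matrix ι ι ℂ) : ℝ :=
  sInf (roofValues f ρ)

/-- Two-tangle `2 (1 - Tr ρ_A ^ 2)` of a two-qubit pure state. -/
noncomputable def pureTwoTangle (φ : Ket (Fin 2 × Fin 2)) : ℝ :=
  2 * (1 - (Matrix.trace (traceSnd (proj φ) ^ 2)).re)

/-- Two-tangle of a two-qubit density matrix. -/
noncomputable def twoTangle (ρ : Matrix (Fin 2 × Fin 2) (Fin 2 × Fin 2) ℂ) : ℝ :=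
  convexRoof pureTwoTangle ρ

/-- Vectors of three qubits: `ψ ![a, b, c]` is the coefficient of `|abc⟩`. -/
abbrev Ket3 : Type := Ket (Fin 3 → Fin 2)

/-- Reduced density matrix of qubits `A`, `B`. -/
def rhoAB (ψ : Ket3) : Matrix (Fin 2 × Fin 2) (Fin 2 × Fin 2) ℂ :=
  Matrix.of fun x y => ∑ c, proj ψ ![x.1, x.2, c] ![y.1, y.2, c]

/-- Reduced density matrix of qubits `A`, `C`. -/
def rhoAC (ψ : Ket3) : Matrix (Fin 2 × Fin 2) (Fin 2 × Fin 2) ℂ :=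
  Matrix.of fun x y => ∑ b, proj ψ ![x.1, b, x.2] ![y.1, b, y.2]

/-- Reduced density matrix of qubits `B`, `C`. -/
def rhoBC (ψ : Ket3) : Matrix (Fin 2 × Fin 2) (Fin 2 × Fin 2) ℂ :=
  Matrix.of fun x y => ∑ a, proj ψ ![a, x.1, x.2] ![a, y.1, y.2]

/-- Reduced density matrix of qubit `A`. -/
def rhoA (ψ : Ket3) : Matrix (Fin 2) (Fin 2) ℂ := traceSnd (rhoAB ψ)

/-- Reduced density matrix of qubit `B`. -/
def rhoB (ψ : Ket3) : Matrix (Fin 2) (Fin 2) ℂ := traceFst (rhoAB ψ)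

/-- `τ_{A|B}`. -/
noncomputable def tauAB (ψ : Ket3) : ℝ := twoTangle (rhoAB ψ)

/-- `τ_{A|C}`. -/
noncomputable def tauAC (ψ : Ket3) : ℝ := twoTangle (rhoAC ψ)

/-- `τ_{B|C}`. -/
noncomputable def tauBC (ψ : Ket3) : ℝ := twoTangle (rhoBC ψ)

/-- `τ_{A|BC} = 2 (1 - Tr ρ_A ^ 2)`. -/
noncomputable def tauA_BC (ψ : Ket3) : ℝ :=
  2 * (1 - (Matrix.trace (rhoA ψ ^ 2)).re)

/-- Three-tangle (residual entanglement) `τ_ABC = τ_{A|BC} - τ_{A|B} - τ_{A|C}`. -/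
noncomputable def threeTangle (ψ : Ket3) : ℝ := tauA_BC ψ - tauAB ψ - tauAC ψ

/-- Third-order negativity `I₅ = Tr ((ρ_BC ^ Γ) ^ 3)`. -/
noncomputable def I5 (ψ : Ket3) : ℝ :=
  (Matrix.trace (partialTranspose (rhoBC ψ) ^ 3)).re

/-- The matrix `2 ρ_AB + ρ_A ⊗ I_B + I_A ⊗ ρ_B`. -/
noncomputable def phiMatrix (ψ : Ket3) : Matrix (Fin 2 × Fin 2) (Fin 2 × Fin 2) ℂ :=
  (2 : ℂ) • rhoAB ψ + rhoA ψ ⊗ₖ (1 : Matrix (Fin 2) (Fin 2) ℂ)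
    + (1 : Matrix (Fin 2) (Fin 2) ℂ) ⊗ₖ rhoB ψ

/-- `φ_ABC = 69 - Tr ((2 ρ_AB + ρ_A ⊗ I_B + I_A ⊗ ρ_B) ^ 3) - 3 Tr (ρ_AB ^ 2)`. -/
noncomputable def phiABC (ψ : Ket3) : ℝ :=
  69 - (Matrix.trace (phiMatrix ψ ^ 3)).re - 3 * (Matrix.trace (rhoAB ψ ^ 2)).re

/-- The state obtained from `ψ` by permuting the three qubits according to `σ`. -/
noncomputable def permuteQubits (σ : Equiv.Perm (Fin 3)) (ψ : Ket3) : Ket3 :=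
  WithLp.toLp 2 fun x => ψ fun i => x (σ i)

/-! All the traces above are real, so that taking real parts loses nothing. -/

theorem trace_pow_im {ι : Type} [Fintype ι] [DecidableEq ι] {M : Matrix ι ι ℂ}
    (h : M.IsHermitian) (k : ℕ) : (Matrix.trace (M ^ k)).im = 0 := by
  have h2 : (M ^ k).IsHermitian := h.pow k
  have h3 : star (Matrix.trace (M ^ k)) = Matrix.trace (M ^ k) := by
    rw [← Matrix.trace_conjTranspose, h2.eq]
  exact Complex.conj_eq_iff_im.mp h3

theorem proj_star {ι : Type} [Fintype ι] (ψ : Ket ι) (i j : ι) :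
    star (proj ψ j i) = proj ψ i j := by
  simp [proj, mul_comm]

theorem traceSnd_proj_isHermitian (φ : Ket (Fin 2 × Fin 2)) :
    (traceSnd (proj φ)).IsHermitian := by
  ext a a'
  simp only [Matrix.conjTranspose_apply, traceSnd, Matrix.of_apply, star_sum, proj_star]

theorem rhoAB_isHermitian (ψ : Ket3) : (rhoAB ψ).IsHermitian := by
  ext a a'
  simp only [Matrix.conjTranspose_apply, rhoAB, Matrix.of_apply, star_sum, proj_star]

theorem rhoA_isHermitian (ψ : Ket3) : (rhoA ψ).IsHermitian := by
  ext a a'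
  simp only [Matrix.conjTranspose_apply, rhoA, traceSnd, rhoAB, Matrix.of_apply, star_sum,
    proj_star]

theorem rhoB_isHermitian (ψ : Ket3) : (rhoB ψ).IsHermitian := by
  ext a a'
  simp only [Matrix.conjTranspose_apply, rhoB, traceFst, rhoAB, Matrix.of_apply, star_sum,
    proj_star]

theorem partialTranspose_rhoBC_isHermitian (ψ : Ket3) :
    (partialTranspose (rhoBC ψ)).IsHermitian := by
  ext a a'
  simp only [Matrix.conjTranspose_apply, partialTranspose, rhoBC, Matrix.of_apply, star_sum,
    proj_star]

theorem phiMatrix_isHermitian (ψ : Ket3) : (phiMatrix ψ).IsHermitian := by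
  have hA := (rhoA_isHermitian ψ).eq
  have hB := (rhoB_isHermitian ψ).eq
  have hAB := (rhoAB_isHermitian ψ).eq
  simp [Matrix.IsHermitian, phiMatrix, Matrix.conjTranspose_add, Matrix.conjTranspose_smul,
    Matrix.conjTranspose_kronecker, hA, hB, hAB]

/-! The infimum in the two-tangle of a density matrix is taken over a non-empty set of
non-negative numbers, and the two-qubit marginals of a three-qubit state are density matrices. -/

theorem roofValues_nonempty {ι : Type} [Fintype ι] [DecidableEq ι] (f : Ket ι → ℝ)
    {ρ : Matrix ι ι ℂ} (h : ρ.PosSemidef) (ht : ρ.trace = 1) : (roofValues f ρ).Nonempty := by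
  let e := (Fintype.equivFin ι).symm
  refine ⟨_, Fintype.card ι, fun l => h.1.eigenvalues (e l),
    fun l => h.1.eigenvectorBasis (e l), ⟨fun l => h.eigenvalues_nonneg _, ?_, ?_, ?_⟩, rfl⟩
  · have := h.1.trace_eq_sum_eigenvalues
    rw [ht] at this
    rw [e.sum_comp (fun i => h.1.eigenvalues i)]
    simpa using (congrArg Complex.re this).symm
  · intro l
    exact h.1.eigenvectorBasis.orthonormal.1 _
  · rw [e.sum_comp (fun i => (h.1.eigenvalues i : ℂ) • proj (h.1.eigenvectorBasis i))]
    conv_rhs => rw [h.1.spectral_theorem]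
    ext i j
    simp [Matrix.sum_apply, Unitary.conjStarAlgAut_apply, Matrix.mul_apply, Matrix.diagonal,
      proj, Matrix.star_apply, Matrix.IsHermitian.eigenvectorUnitary_apply]
    refine Finset.sum_congr rfl fun x _ => ?_
    ring

theorem pureTwoTangle_nonneg (φ : Ket (Fin 2 × Fin 2)) (h : ‖φ‖ = 1) : 0 ≤ pureTwoTangle φ := by
  have h1 : ‖φ‖ ^ 2 = 1 := by rw [h]; norm_num
  rw [EuclideanSpace.norm_sq_eq] at h1
  simp only [Fintype.sum_prod_type, Fin.sum_univ_two, Complex.sq_norm, Complex.normSq_apply] at h1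
  have key : pureTwoTangle φ
      = 4 * Complex.normSq (φ (0, 0) * φ (1, 1) - φ (0, 1) * φ (1, 0)) := by
    simp only [pureTwoTangle, pow_two, Matrix.trace, Matrix.diag, Matrix.mul_apply, traceSnd, proj,
      Matrix.of_apply, Fin.sum_univ_two, Complex.normSq_apply, Complex.add_re, Complex.add_im,
      Complex.mul_re, Complex.mul_im, Complex.sub_re, Complex.sub_im, Complex.star_def,
      Complex.conj_re, Complex.conj_im]
    generalize (φ (0, 0)).re = a at *
    generalize (φ (0, 0)).im = a' at *
    generalize (φ (0, 1)).re = b at *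
    generalize (φ (0, 1)).im = b' at *
    generalize (φ (1, 0)).re = c at *
    generalize (φ (1, 0)).im = c' at *
    generalize (φ (1, 1)).re = d at *
    generalize (φ (1, 1)).im = d' at *
    linear_combination (-2 * (a * a + a' * a' + (b * b + b' * b') + (c * c + c' * c'
      + (d * d + d' * d'))) - 2) * h1
  rw [key]
  exact mul_nonneg (by norm_num) (Complex.normSq_nonneg _)

theorem roofValues_pureTwoTangle_bddBelow (ρ : Matrix (Fin 2 × Fin 2) (Fin 2 × Fin 2) ℂ) :
    BddBelow (roofValues pureTwoTangle ρ) := by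
  refine ⟨0, ?_⟩
  rintro r ⟨n, p, φ, h, rfl⟩
  exact Finset.sum_nonneg fun l _ =>
    mul_nonneg (h.nonneg l) (pureTwoTangle_nonneg _ (h.norm_eq_one l))

theorem posSemidef_of_sum {ι κ : Type} [Fintype ι] [Fintype κ] (v : κ → ι → ℂ) :
    (Matrix.of fun i j => ∑ k, v k i * star (v k j) : Matrix ι ι ℂ).PosSemidef := by
  have : (Matrix.of fun i j => ∑ k, v k i * star (v k j) : Matrix ι ι ℂ)
      = ∑ k, Matrix.vecMulVec (v k) (star (v k)) := by
    ext i j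
    simp [Matrix.sum_apply, Matrix.vecMulVec_apply]
  rw [this]
  exact Matrix.posSemidef_sum _ fun k _ => Matrix.posSemidef_vecMulVec_self_star _

theorem rhoAB_posSemidef (ψ : Ket3) : (rhoAB ψ).PosSemidef :=
  posSemidef_of_sum fun c (x : Fin 2 × Fin 2) => ψ ![x.1, x.2, c]

theorem rhoAC_posSemidef (ψ : Ket3) : (rhoAC ψ).PosSemidef :=
  posSemidef_of_sum fun b (x : Fin 2 × Fin 2) => ψ ![x.1, b, x.2]

theorem rhoBC_posSemidef (ψ : Ket3) : (rhoBC ψ).PosSemidef :=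
  posSemidef_of_sum fun a (x : Fin 2 × Fin 2) => ψ ![a, x.1, x.2]

theorem sum_ket3 (f : (Fin 3 → Fin 2) → ℂ) : ∑ x, f x = ∑ a, ∑ b, ∑ c, f ![a, b, c] := by
  let e : Fin 2 × Fin 2 × Fin 2 ≃ (Fin 3 → Fin 2) :=
    { toFun := fun t => ![t.1, t.2.1, t.2.2]
      invFun := fun x => (x 0, x 1, x 2)
      left_inv := fun t => by simp
      right_inv := fun x => by ext i; fin_cases i <;> rfl }
  rw [← e.sum_comp f]
  simp [Fintype.sum_prod_type, e]

theorem sum_proj_diag (ψ : Ket3) (h : ‖ψ‖ = 1) : ∑ a, ∑ b, ∑ c,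
    proj ψ ![a, b, c] ![a, b, c] = 1 := by
  rw [← sum_ket3 fun x => proj ψ x x]
  have h1 : ‖ψ‖ ^ 2 = 1 := by rw [h]; norm_num
  rw [EuclideanSpace.norm_sq_eq] at h1
  have h2 := congrArg (fun r : ℝ => (r : ℂ)) h1
  simpa [proj, Complex.mul_conj, Complex.normSq_eq_norm_sq] using h2

theorem rhoAB_trace (ψ : Ket3) (h : ‖ψ‖ = 1) : (rhoAB ψ).trace = 1 := by
  rw [← sum_proj_diag ψ h]
  simp [Matrix.trace, rhoAB, Fintype.sum_prod_type]

theorem rhoAC_trace (ψ : Ket3) (h : ‖ψ‖ = 1) : (rhoAC ψ).trace = 1 := by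
  rw [← sum_proj_diag ψ h]
  simp [Matrix.trace, rhoAC, Fintype.sum_prod_type]
  ring

theorem rhoBC_trace (ψ : Ket3) (h : ‖ψ‖ = 1) : (rhoBC ψ).trace = 1 := by
  rw [← sum_proj_diag ψ h]
  simp [Matrix.trace, rhoBC, Fintype.sum_prod_type]
  ring

end ThreeQubit

namespace ThreeQubit

/-! On a unit vector the two-tangle is the squared modulus of the spin-flip form, a complex
symmetric bilinear form. Tracing one qubit out of `ψ` leaves a sum of two projectors, on which the
form is a symmetric 2×2 matrix. A unitary change of ensemble makes this matrix diagonal (Takagi),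
with singular values λ₁ ≥ λ₂, and the convex roof equals (λ₁ - λ₂)² (Wootters). This is the squared
Frobenius norm minus twice the modulus of the determinant, so no diagonalization remains in
`twoTangle_proj_add_proj`.

The determinant is the same for all three pairs: up to sign it is Cayley's hyperdeterminant. The
Frobenius terms of the two pairs sharing a qubit add up to twice its linear entropy. Hence
`tau_sum_eq` and `threeTangle_eq` express the tangles by the three purities and |det|. The
polynomial identity `trace_phiMatrix_pow_three` expresses `phiABC` by `I5` and the purities. In the
final formula |det| cancels, since 27 · 6 = (81/2) · 4. -/

/-! ### The spin-flip form and pure states -/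

/-- The spin-flip bilinear form `⟨v*|σ_y ⊗ σ_y|w⟩`, up to sign. -/
def spinFlip (v w : Ket (Fin 2 × Fin 2)) : ℂ :=
  v (0, 0) * w (1, 1) + v (1, 1) * w (0, 0) - v (0, 1) * w (1, 0) - v (1, 0) * w (0, 1)

theorem spinFlip_comm (v w : Ket (Fin 2 × Fin 2)) : spinFlip v w = spinFlip w v := by
  simp only [spinFlip]; ring

theorem spinFlip_comb_left (a b : ℂ) (v w z : Ket (Fin 2 × Fin 2)) :
    spinFlip (a • v + b • w) z = a * spinFlip v z + b * spinFlip w z := by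
  simp only [spinFlip, PiLp.add_apply, PiLp.smul_apply, smul_eq_mul]; ring

theorem spinFlip_comb_right (a b : ℂ) (v w z : Ket (Fin 2 × Fin 2)) :
    spinFlip z (a • v + b • w) = a * spinFlip z v + b * spinFlip z w := by
  simp only [spinFlip, PiLp.add_apply, PiLp.smul_apply, smul_eq_mul]; ring

theorem spinFlip_smul_smul (a b : ℂ) (v w : Ket (Fin 2 × Fin 2)) :
    spinFlip (a • v) (b • w) = a * b * spinFlip v w := by
  simp only [spinFlip, PiLp.smul_apply, smul_eq_mul]; ring

/-- The spin-flip form as a linear functional of its second argument. -/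
def spinFlipRight (v : Ket (Fin 2 × Fin 2)) : Ket (Fin 2 × Fin 2) →ₗ[ℂ] ℂ where
  toFun := spinFlip v
  map_add' x y := by simp only [spinFlip, PiLp.add_apply]; ring
  map_smul' c x := by simp only [spinFlip, PiLp.smul_apply, smul_eq_mul, RingHom.id_apply]; ring

theorem pureTwoTangle_eq (φ : Ket (Fin 2 × Fin 2)) (h : ‖φ‖ = 1) :
    pureTwoTangle φ = ‖spinFlip φ φ‖ ^ 2 := by
  have h1 : ‖φ‖ ^ 2 = 1 := by rw [h]; norm_num
  rw [EuclideanSpace.norm_sq_eq] at h1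
  simp only [Fintype.sum_prod_type, Fin.sum_univ_two, Complex.sq_norm, Complex.normSq_apply] at h1
  rw [← Complex.normSq_eq_norm_sq]
  simp only [pureTwoTangle, pow_two, Matrix.trace, Matrix.diag, Matrix.mul_apply, traceSnd, proj,
    Matrix.of_apply, Fin.sum_univ_two, spinFlip, Complex.normSq_apply, Complex.add_re, Complex.add_im,
    Complex.mul_re, Complex.mul_im, Complex.sub_re, Complex.sub_im, Complex.star_def,
    Complex.conj_re, Complex.conj_im]
  generalize (φ (0, 0)).re = a at *
  generalize (φ (0, 0)).im = a' at *
  generalize (φ (0, 1)).re = b at *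
  generalize (φ (0, 1)).im = b' at *
  generalize (φ (1, 0)).re = c at *
  generalize (φ (1, 0)).im = c' at *
  generalize (φ (1, 1)).re = d at *
  generalize (φ (1, 1)).im = d' at *
  -- With N the squared norm, the two sides differ by 2 - 2N² = (-2N - 2)(N - 1).
  linear_combination (-2 * (a * a + a' * a' + (b * b + b' * b') + (c * c + c' * c'
    + (d * d + d' * d'))) - 2) * h1

/-! ### Ensembles of a sum of two projectors -/

theorem trace_proj {ι : Type} [Fintype ι] (v : Ket ι) :
    (proj v).trace = ((‖v‖ ^ 2 : ℝ) : ℂ) := by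
  rw [EuclideanSpace.norm_sq_eq]
  simp [proj, Matrix.trace, Complex.mul_conj, Complex.normSq_eq_norm_sq]

theorem proj_smul {ι : Type} [Fintype ι] (c : ℂ) (v : Ket ι) :
    proj (c • v) = (c * star c) • proj v := by
  ext i j
  simp only [proj, Matrix.of_apply, Matrix.smul_apply, PiLp.smul_apply, smul_eq_mul, star_mul']
  ring

/-- A unitary change of the vectors of an ensemble does not change its density matrix. -/
theorem proj_add_proj_rotate {ι : Type} [Fintype ι] (a b : ℂ) (h : a * star a + b * star b = 1)
    (v w : Ket ι) :
    proj (a • v + b • w) + proj ((-star b) • v + star a • w) = proj v + proj w := by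
  ext i j
  simp only [proj, Matrix.of_apply, Matrix.add_apply, PiLp.smul_apply, PiLp.add_apply,
    smul_eq_mul, star_mul', star_add, star_neg, star_star]
  linear_combination (v i * star (v j) + w i * star (w j)) * h

theorem normSq_functional {ι : Type} [Fintype ι] [DecidableEq ι] (L : Ket ι →ₗ[ℂ] ℂ) (v : Ket ι) :
    ((‖L v‖ ^ 2 : ℝ) : ℂ) = ∑ i, ∑ j, L (EuclideanSpace.single i 1) *
      star (L (EuclideanSpace.single j 1)) * proj v i j := by
  have hv : L v = ∑ i, v i * L (EuclideanSpace.single i 1) := by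
    conv_lhs => rw [← (EuclideanSpace.basisFun ι ℂ).sum_repr v]
    simp [map_sum, map_smul]
  rw [Complex.ofReal_pow, ← Complex.mul_conj', hv, map_sum, Finset.sum_mul_sum]
  refine Finset.sum_congr rfl fun i _ => Finset.sum_congr rfl fun j _ => ?_
  simp only [proj, Matrix.of_apply, map_mul, Complex.star_def]
  ring

/-- The average of |L|² is linear in the density matrix, hence independent of the ensemble. -/
theorem IsPureDecomposition.sum_normSq_functional {ι : Type} [Fintype ι] [DecidableEq ι]
    {v w : Ket ι} {n : ℕ} {p : Fin n → ℝ} {φ : Fin n → Ket ι}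
    (h : IsPureDecomposition (proj v + proj w) p φ) (L : Ket ι →ₗ[ℂ] ℂ) :
    ∑ l, p l * ‖L (φ l)‖ ^ 2 = ‖L v‖ ^ 2 + ‖L w‖ ^ 2 := by
  apply Complex.ofReal_injective
  push_cast [← Complex.ofReal_pow]
  simp only [normSq_functional]
  have h2 : ∀ i j, proj v i j + proj w i j = ∑ l, (p l : ℂ) * proj (φ l) i j := by
    intro i j
    rw [← Matrix.add_apply, ← h.sum_proj]
    simp [Matrix.sum_apply]
  simp only [← Finset.sum_add_distrib, ← mul_add, h2, Finset.mul_sum]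
  rw [Finset.sum_comm]
  refine Finset.sum_congr rfl fun i _ => ?_
  rw [Finset.sum_comm]
  refine Finset.sum_congr rfl fun j _ => Finset.sum_congr rfl fun l _ => ?_
  ring

/-- If z is orthogonal to v and w, the average of |⟨z, φ l⟩|² is zero, so every term of nonzero
weight vanishes; then take the double orthogonal complement. -/
theorem IsPureDecomposition.mem_span {ι : Type} [Fintype ι] [DecidableEq ι]
    {v w : Ket ι} {n : ℕ} {p : Fin n → ℝ} {φ : Fin n → Ket ι}
    (h : IsPureDecomposition (proj v + proj w) p φ) (l : Fin n) (hl : p l ≠ 0) :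
    ∃ x y : ℂ, x • v + y • w = φ l := by
  rw [← Submodule.mem_span_pair,
    ← Submodule.orthogonal_orthogonal (Submodule.span ℂ ({v, w} : Set (Ket ι)))]
  rw [Submodule.mem_orthogonal]
  intro z hz
  rw [Submodule.mem_orthogonal'] at hz
  have hv : inner ℂ z v = 0 := hz v (Submodule.subset_span (by simp))
  have hw : inner ℂ z w = 0 := hz w (Submodule.subset_span (by simp))
  have key := h.sum_normSq_functional (innerSL ℂ z).toLinearMap
  simp only [ContinuousLinearMap.coe_coe, innerSL_apply_apply, hv, hw] at key
  rw [norm_zero, zero_pow two_ne_zero, add_zero, Finset.sum_eq_zero_iff_of_nonneg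
    fun i _ => mul_nonneg (h.nonneg i) (sq_nonneg _)] at key
  simpa [hl] using key l (Finset.mem_univ l)

/-! ### The convex roof when the form is diagonal -/

/-- For φ = xv + yw the form is x²r + y²s, of modulus at least |x|²|r| - |y|²|s|. These two terms
are recovered from the functionals `spinFlip v` and `spinFlip w`, whose averages are known;
coordinates would be ambiguous if v and w are dependent. -/
theorem IsPureDecomposition.le_sum_norm_spinFlip {v w : Ket (Fin 2 × Fin 2)} {n : ℕ}
    {p : Fin n → ℝ} {φ : Fin n → Ket (Fin 2 × Fin 2)}
    (h : IsPureDecomposition (proj v + proj w) p φ) (hvw : spinFlip v w = 0) :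
    ‖spinFlip v v‖ - ‖spinFlip w w‖ ≤ ∑ l, p l * ‖spinFlip (φ l) (φ l)‖ := by
  have hv := h.sum_normSq_functional (spinFlipRight v)
  have hw := h.sum_normSq_functional (spinFlipRight w)
  have hwv : spinFlip w v = 0 := by rw [spinFlip_comm, hvw]
  simp only [spinFlipRight, LinearMap.coe_mk, AddHom.coe_mk, hvw, hwv, norm_zero] at hv hw
  -- At a = 0 this relies on division by zero giving zero, so a degenerate form needs no separate
  -- treatment.
  have hdiv : ∀ a : ℝ, a ^ 2 / a = a := fun a => by
    rcases eq_or_ne a 0 with rfl | ha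
    · simp
    · field_simp
  calc ‖spinFlip v v‖ - ‖spinFlip w w‖
      = ∑ l, p l * (‖spinFlip v (φ l)‖ ^ 2 / ‖spinFlip v v‖
          - ‖spinFlip w (φ l)‖ ^ 2 / ‖spinFlip w w‖) := by
        simp only [mul_sub, Finset.sum_sub_distrib, ← mul_div_assoc, ← Finset.sum_div]
        rw [hv, hw]
        simp [hdiv]
    _ ≤ _ := by
        refine Finset.sum_le_sum fun l _ => ?_
        rcases eq_or_ne (p l) 0 with hl | hl
        · simp [hl]
        refine mul_le_mul_of_nonneg_left ?_ (h.nonneg l)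
        obtain ⟨x, y, hxy⟩ := h.mem_span l hl
        rw [← hxy]
        simp only [spinFlip_comb_left, spinFlip_comb_right, hvw, hwv, mul_zero, add_zero, zero_add,
          norm_mul, mul_pow]
        have h1 : ‖x‖ ^ 2 * ‖spinFlip v v‖ ^ 2 / ‖spinFlip v v‖ = ‖x‖ ^ 2 * ‖spinFlip v v‖ := by
          rw [mul_div_assoc, hdiv]
        have h2 : ‖y‖ ^ 2 * ‖spinFlip w w‖ ^ 2 / ‖spinFlip w w‖ = ‖y‖ ^ 2 * ‖spinFlip w w‖ := by
          rw [mul_div_assoc, hdiv]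
        rw [h1, h2]
        have := norm_sub_norm_le (x * (x * spinFlip v v)) (-(y * (y * spinFlip w w)))
        rw [norm_neg, sub_neg_eq_add] at this
        simp only [norm_mul] at this
        nlinarith [this]

theorem exists_unit_sq_mul_eq_norm (z : ℂ) : ∃ c : ℂ, c * star c = 1 ∧ c * c * z = ‖z‖ := by
  refine ⟨Complex.exp (-(z.arg / 2 : ℝ) * Complex.I), ?_, ?_⟩
  · rw [Complex.star_def, ← Complex.exp_conj, ← Complex.exp_add, map_mul, map_neg,
      Complex.conj_ofReal, Complex.conj_I]
    simp
  · rw [← Complex.exp_add]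
    nth_rw 3 [← Complex.norm_mul_exp_arg_mul_I z]
    rw [mul_left_comm, ← Complex.exp_add]
    rw [show -(z.arg / 2 : ℝ) * Complex.I + -(z.arg / 2 : ℝ) * Complex.I + z.arg * Complex.I = 0 by
      push_cast; ring, Complex.exp_zero, mul_one]

/-- Rotating the ensemble by a real angle until both members have form value (r + s) times their
squared norm makes the tangle constant over the ensemble. -/
theorem exists_isPureDecomposition (v w : Ket (Fin 2 × Fin 2))
    (ht : (proj v + proj w).trace = 1) {r s : ℝ} (hv : spinFlip v v = r) (hw : spinFlip w w = s)
    (hvw : spinFlip v w = 0) :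
    ∃ (p : Fin 2 → ℝ) (φ : Fin 2 → Ket (Fin 2 × Fin 2)),
      IsPureDecomposition (proj v + proj w) p φ ∧
        ∀ l, p l * ‖spinFlip (φ l) (φ l)‖ ^ 2 = p l * (r + s) ^ 2 := by
  have hwv : spinFlip w v = 0 := by rw [spinFlip_comm, hvw]
  let c : ℝ → ℂ := fun θ => (Real.cos θ : ℂ)
  let d : ℝ → ℂ := fun θ => (Real.sin θ : ℂ)
  let x : ℝ → Ket (Fin 2 × Fin 2) := fun θ => c θ • v + d θ • w
  let y : ℝ → Ket (Fin 2 × Fin 2) := fun θ => (-d θ) • v + c θ • w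
  have hcd : ∀ θ, c θ * star (c θ) + d θ * star (d θ) = 1 := fun θ => by
    simp only [c, d, Complex.star_def, Complex.conj_ofReal]
    exact_mod_cast (by nlinarith [Real.sin_sq_add_cos_sq θ] :
      Real.cos θ * Real.cos θ + Real.sin θ * Real.sin θ = 1)
  have hxy : ∀ θ, proj (x θ) + proj (y θ) = proj v + proj w := fun θ => by
    have := proj_add_proj_rotate (c θ) (d θ) (hcd θ) v w
    simpa [x, y, c, d, ← Complex.ofReal_cos, ← Complex.ofReal_sin] using this
  have hn : ∀ θ, ‖x θ‖ ^ 2 + ‖y θ‖ ^ 2 = 1 := fun θ => by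
    have := congrArg Matrix.trace (hxy θ)
    rw [ht, Matrix.trace_add, trace_proj, trace_proj] at this
    exact_mod_cast this
  have hbx : ∀ θ, spinFlip (x θ) (x θ) = ((Real.cos θ ^ 2 * r + Real.sin θ ^ 2 * s : ℝ) : ℂ) :=
    fun θ => by
      simp only [x, c, d, spinFlip_comb_left, spinFlip_comb_right, hv, hw, hvw, hwv]
      push_cast
      ring
  have hby : ∀ θ, spinFlip (y θ) (y θ) = ((Real.sin θ ^ 2 * r + Real.cos θ ^ 2 * s : ℝ) : ℂ) :=
    fun θ => by
      simp only [y, c, d, spinFlip_comb_left, spinFlip_comb_right, hv, hw, hvw, hwv]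
      push_cast
      ring
  -- The defect of the first member. A quarter turn exchanges the two members up to sign, which
  -- negates it, so it vanishes in between.
  let f : ℝ → ℝ := fun θ => Real.cos θ ^ 2 * r + Real.sin θ ^ 2 * s - (r + s) * ‖x θ‖ ^ 2
  have hf : Continuous f := by
    have hc : Continuous c := Complex.continuous_ofReal.comp Real.continuous_cos
    have hd : Continuous d := Complex.continuous_ofReal.comp Real.continuous_sin
    have hx : Continuous x := (hc.smul continuous_const).add (hd.smul continuous_const)
    fun_prop
  have hnvw : ‖v‖ ^ 2 + ‖w‖ ^ 2 = 1 := by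
    rw [Matrix.trace_add, trace_proj, trace_proj] at ht
    exact_mod_cast ht
  have hf0 : f 0 = r - (r + s) * ‖v‖ ^ 2 := by simp [f, x, c, d]
  have hf1 : f (Real.pi / 2) = s - (r + s) * ‖w‖ ^ 2 := by simp [f, x, c, d]
  have hf2 : f (Real.pi / 2) = - f 0 := by
    rw [hf0, hf1]; linear_combination (-(r + s)) * hnvw
  obtain ⟨θ, -, hθ⟩ : ∃ θ ∈ Set.uIcc 0 (Real.pi / 2), f θ = 0 := by
    have := intermediate_value_uIcc (a := 0) (b := Real.pi / 2) hf.continuousOn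
    apply this
    rw [hf2, Set.mem_uIcc]
    rcases le_total 0 (f 0) with h | h
    · right; constructor <;> linarith
    · left; constructor <;> linarith
  have hsc := Real.sin_sq_add_cos_sq θ
  have h1 : spinFlip (x θ) (x θ) = (((r + s) * ‖x θ‖ ^ 2 : ℝ) : ℂ) := by
    rw [hbx]
    congr 1
    simp only [f] at hθ
    linarith
  have h2 : spinFlip (y θ) (y θ) = (((r + s) * ‖y θ‖ ^ 2 : ℝ) : ℂ) := by
    rw [hby]
    congr 1
    simp only [f] at hθ
    -- The form values sum to r + s and the squared norms to 1, so the second defect is minus the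
    -- first.
    linear_combination (r + s) * hsc - hθ - (r + s) * hn θ
  have normalize : ∀ u : Ket (Fin 2 × Fin 2),
      spinFlip u u = (((r + s) * ‖u‖ ^ 2 : ℝ) : ℂ) →
      ∃ φ : Ket (Fin 2 × Fin 2), ‖φ‖ = 1 ∧ ((‖u‖ ^ 2 : ℝ) : ℂ) • proj φ = proj u ∧
        ‖u‖ ^ 2 * ‖spinFlip φ φ‖ ^ 2 = ‖u‖ ^ 2 * (r + s) ^ 2 := by
    intro u hu
    rcases eq_or_ne u 0 with rfl | h0
    -- The weight is zero, so any unit vector serves.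
    · refine ⟨EuclideanSpace.single (0, 0) 1, by simp, ?_, by simp⟩
      ext i j
      simp [proj]
    have hu0 : ‖u‖ ≠ 0 := norm_ne_zero_iff.mpr h0
    have huC : (‖u‖ : ℂ) ≠ 0 := by exact_mod_cast hu0
    refine ⟨((‖u‖⁻¹ : ℝ) : ℂ) • u, ?_, ?_, ?_⟩
    · rw [norm_smul, Complex.norm_real, norm_inv, norm_norm, inv_mul_cancel₀ hu0]
    · rw [proj_smul, smul_smul, Complex.star_def, Complex.conj_ofReal]
      push_cast
      rw [show (‖u‖ : ℂ) ^ 2 * ((‖u‖ : ℂ)⁻¹ * (‖u‖ : ℂ)⁻¹) = 1 by field_simp, one_smul]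
    · rw [spinFlip_smul_smul, hu, ← Complex.ofReal_mul, ← Complex.ofReal_mul, Complex.norm_real,
        Real.norm_eq_abs, sq_abs]
      field_simp
  obtain ⟨φ₀, hφ₀, hp₀, ht₀⟩ := normalize _ h1
  obtain ⟨φ₁, hφ₁, hp₁, ht₁⟩ := normalize _ h2
  refine ⟨![‖x θ‖ ^ 2, ‖y θ‖ ^ 2], ![φ₀, φ₁], ⟨?_, ?_, ?_, ?_⟩, ?_⟩
  · intro l; fin_cases l <;> simp
  · simpa using hn θ
  · intro l; fin_cases l <;> simpa
  · simp only [Fin.sum_univ_two, Matrix.cons_val_zero, Matrix.cons_val_one]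
    rw [hp₀, hp₁, hxy]
  · intro l
    fin_cases l
    exacts [ht₀, ht₁]

theorem twoTangle_of_spinFlip_eq_zero (v w : Ket (Fin 2 × Fin 2))
    (ht : (proj v + proj w).trace = 1) (hvw : spinFlip v w = 0)
    (hle : ‖spinFlip w w‖ ≤ ‖spinFlip v v‖) :
    twoTangle (proj v + proj w) = (‖spinFlip v v‖ - ‖spinFlip w w‖) ^ 2 := by
  apply IsLeast.csInf_eq
  constructor
  -- Phases make the form value of v nonnegative and that of w nonpositive, so that r + s becomes
  -- the difference of the moduli.
  · obtain ⟨c, hc, hcv⟩ := exists_unit_sq_mul_eq_norm (spinFlip v v)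
    obtain ⟨d, hd, hdw⟩ := exists_unit_sq_mul_eq_norm (-spinFlip w w)
    have hρ : proj (c • v) + proj (d • w) = proj v + proj w := by
      rw [proj_smul, proj_smul, hc, hd, one_smul, one_smul]
    obtain ⟨p, φ, h, hl⟩ := exists_isPureDecomposition (c • v) (d • w) (by rw [hρ, ht])
      (r := ‖spinFlip v v‖) (s := -‖spinFlip w w‖)
      (by rw [spinFlip_smul_smul, hcv])
      (by rw [spinFlip_smul_smul]; push_cast; rw [← norm_neg, ← hdw]; ring)
      (by rw [spinFlip_smul_smul, hvw, mul_zero])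
    rw [hρ] at h
    refine ⟨2, p, φ, h, ?_⟩
    simp only [fun l => pureTwoTangle_eq _ (h.norm_eq_one l), hl, ← Finset.sum_mul, h.sum_eq_one]
    ring
  · rintro _ ⟨n, p, φ, h, rfl⟩
    have h1 := h.le_sum_norm_spinFlip hvw
    set C := ‖spinFlip v v‖ - ‖spinFlip w w‖
    have hC : 0 ≤ C := sub_nonneg.mpr hle
    -- The tangent line to the square at C, i.e. t² ≥ 2Ct - C², turns the bound on average moduli
    -- into one on average squares.
    have h2 : ∑ l, p l * (2 * C * ‖spinFlip (φ l) (φ l)‖ - C ^ 2)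
        ≤ ∑ l, p l * pureTwoTangle (φ l) := by
      refine Finset.sum_le_sum fun l _ => mul_le_mul_of_nonneg_left ?_ (h.nonneg l)
      rw [pureTwoTangle_eq _ (h.norm_eq_one l)]
      nlinarith [sq_nonneg (‖spinFlip (φ l) (φ l)‖ - C)]
    have h3 : ∑ l, p l * (2 * C * ‖spinFlip (φ l) (φ l)‖ - C ^ 2)
        = 2 * C * ∑ l, p l * ‖spinFlip (φ l) (φ l)‖ - C ^ 2 := by
      simp only [mul_sub, Finset.sum_sub_distrib, ← Finset.sum_mul, h.sum_eq_one, Finset.mul_sum]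
      rw [one_mul]
      congr 1
      exact Finset.sum_congr rfl fun l _ => by ring
    nlinarith [mul_le_mul_of_nonneg_left h1 hC]

/-! ### Takagi diagonalization and the rank-two formula -/

/-- Takagi diagonalization of a symmetric form of two variables. -/
theorem exists_takagi (r t s : ℂ) : ∃ a b : ℂ, a * star a + b * star b = 1 ∧
    a * (-star b) * r + (a * star a - b * star b) * t + b * star a * s = 0 ∧
    ‖star b * star b * r - 2 * star a * star b * t + star a * star a * s‖ ≤
      ‖a * a * r + 2 * a * b * t + b * b * s‖ := by
  let K : Set (ℂ × ℂ) := {q | q.1 * star q.1 + q.2 * star q.2 = 1}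
  have hK' : ∀ q : ℂ × ℂ, q ∈ K ↔ ‖q.1‖ ^ 2 + ‖q.2‖ ^ 2 = 1 := fun q => by
    simp only [K, Set.mem_ofPred_eq, Complex.star_def, Complex.mul_conj']
    norm_cast
  have hK : IsCompact K := by
    refine Metric.isCompact_of_isClosed_isBounded
      (isClosed_eq (by fun_prop) continuous_const) ?_
    refine (Metric.isBounded_closedBall (x := (0 : ℂ × ℂ)) (r := 1)).subset fun q hq => ?_
    rw [hK'] at hq
    rw [mem_closedBall_zero_iff, Prod.norm_def, max_le_iff]
    constructor <;> nlinarith [norm_nonneg q.1, norm_nonneg q.2]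
  let g : ℂ × ℂ → ℝ := fun q => ‖q.1 * q.1 * r + 2 * q.1 * q.2 * t + q.2 * q.2 * s‖
  -- The first row of the unitary maximizes the modulus of the quadratic form on the unit sphere.
  obtain ⟨⟨a, b⟩, hab, hmax⟩ := hK.exists_isMaxOn (f := g) ⟨(1, 0), by simp [K]⟩
    (by fun_prop : Continuous g).continuousOn
  have hab' : a * star a + b * star b = 1 := hab
  set R := a * a * r + 2 * a * b * t + b * b * s with hR
  set T := a * (-star b) * r + (a * star a - b * star b) * t + b * star a * s with hT
  set S := star b * star b * r - 2 * star a * star b * t + star a * star a * s with hS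
  -- Maximality tested on the normalization of (1, z) in the rotated basis, where the form has
  -- entries R, T, S.
  have hbound : ∀ z : ℂ, ‖R + 2 * z * T + z * z * S‖ ≤ (1 + ‖z‖ ^ 2) * ‖R‖ := by
    intro z
    have hpos : 0 < 1 + ‖z‖ ^ 2 := by positivity
    set k : ℝ := (Real.sqrt (1 + ‖z‖ ^ 2))⁻¹ with hk
    have hk2 : k ^ 2 * (1 + ‖z‖ ^ 2) = 1 := by
      rw [hk, inv_pow, Real.sq_sqrt hpos.le, inv_mul_cancel₀ hpos.ne']
    have hk2' : (k : ℂ) ^ 2 * (1 + z * star z) = 1 := by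
      rw [Complex.star_def, Complex.mul_conj']
      exact_mod_cast hk2
    have hmem : ((k : ℂ) * (a - z * star b), (k : ℂ) * (b + z * star a)) ∈ K := by
      simp only [K, Set.mem_ofPred_eq, star_mul', star_sub, star_add, star_star]
      rw [Complex.star_def, Complex.conj_ofReal, ← Complex.star_def]
      linear_combination (a * star a + b * star b) * hk2' + hab'
    have := hmax hmem
    simp only [Set.mem_ofPred_eq, g] at this
    have e : (k : ℂ) * (a - z * star b) * (k * (a - z * star b)) * r
        + 2 * (k * (a - z * star b)) * (k * (b + z * star a)) * t
        + k * (b + z * star a) * (k * (b + z * star a)) * s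
        = (k : ℂ) ^ 2 * (R + 2 * z * T + z * z * S) := by
      rw [hR, hT, hS]; ring
    rw [e, norm_mul, norm_pow, Complex.norm_real, Real.norm_eq_abs, sq_abs, ← hR] at this
    calc _ = (1 + ‖z‖ ^ 2) * (k ^ 2 * ‖R + 2 * z * T + z * z * S‖) := by
          linear_combination -‖R + 2 * z * T + z * z * S‖ * hk2
      _ ≤ _ := mul_le_mul_of_nonneg_left this hpos.le
  refine ⟨a, b, hab', ?_, ?_⟩
  · change T = 0
    by_contra hT0
    have hTn : 0 < ‖T‖ := norm_pos_iff.mpr hT0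
    rcases eq_or_ne R 0 with hR0 | hR0
    · simp only [hR0, norm_zero, mul_zero, zero_add, norm_le_zero_iff] at hbound
      exact hT0 (by linear_combination (hbound 1 - hbound (-1)) / 4)
    have hRn : 0 < ‖R‖ := norm_pos_iff.mpr hR0
    -- If T ≠ 0, moving along z = ε R T̄ keeps R + 2zT in phase with R and gains 2ε‖R‖‖T‖². With
    -- this ε the second-order terms cost at most half of that, contradicting maximality.
    set ε : ℝ := (‖R‖ * ‖S‖ + ‖R‖ ^ 2)⁻¹ with hε
    have hden : 0 < ‖R‖ * ‖S‖ + ‖R‖ ^ 2 := by positivity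
    have hε0 : 0 < ε := inv_pos.mpr hden
    have hε1 : ε * (‖R‖ * ‖S‖ + ‖R‖ ^ 2) = 1 := inv_mul_cancel₀ hden.ne'
    set z : ℂ := ε * (R * star T) with hz
    have hzn : ‖z‖ = ε * (‖R‖ * ‖T‖) := by
      rw [hz, norm_mul, norm_mul, Complex.norm_real, Real.norm_eq_abs, abs_of_pos hε0, norm_star]
    have hTT : star T * T = ((‖T‖ ^ 2 : ℝ) : ℂ) := by
      rw [Complex.star_def, Complex.conj_mul']; push_cast; rfl
    have e1 : R + 2 * z * T = R * ((1 + 2 * ε * ‖T‖ ^ 2 : ℝ) : ℂ) := by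
      rw [hz]
      push_cast at hTT ⊢
      linear_combination 2 * ε * R * hTT
    have e2 : ‖R + 2 * z * T‖ = ‖R‖ * (1 + 2 * ε * ‖T‖ ^ 2) := by
      rw [e1, norm_mul, Complex.norm_real, Real.norm_eq_abs, abs_of_pos (by positivity)]
    have h3 := hbound z
    have h4 := norm_sub_le (R + 2 * z * T + z * z * S) (z * z * S)
    rw [add_sub_cancel_right, e2, norm_mul, norm_mul] at h4
    have h5 := h4.trans (add_le_add_left h3 _)
    rw [hzn] at h5
    have h6 : ‖R‖ * ‖T‖ ^ 2 * ε * 2 ≤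
        ‖R‖ * ‖T‖ ^ 2 * ε * (ε * (‖R‖ * ‖S‖ + ‖R‖ ^ 2)) := by nlinarith [h5]
    rw [hε1] at h6
    have h7 : 0 < ‖R‖ * ‖T‖ ^ 2 * ε := by positivity
    linarith
  -- The second row is a unit vector too, so its value is at most the maximum.
  · have hmem : (-star b, star a) ∈ K := by
      simp only [K, Set.mem_ofPred_eq, star_neg, star_star]
      linear_combination hab'
    have := hmax hmem
    simp only [Set.mem_ofPred_eq, g] at this
    have e : -star b * -star b * r + 2 * -star b * star a * t + star a * star a * s
        = star b * star b * r - 2 * star a * star b * t + star a * star a * s := by ring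
    rwa [e] at this

/-- Unitary congruence preserves the Frobenius norm. -/
theorem takagi_frobenius (a b r t s : ℂ) (h : a * star a + b * star b = 1) :
    ‖a * a * r + 2 * a * b * t + b * b * s‖ ^ 2
      + 2 * ‖a * (-star b) * r + (a * star a - b * star b) * t + b * star a * s‖ ^ 2
      + ‖star b * star b * r - 2 * star a * star b * t + star a * star a * s‖ ^ 2
      = ‖r‖ ^ 2 + 2 * ‖t‖ ^ 2 + ‖s‖ ^ 2 := by
  apply Complex.ofReal_injective
  push_cast
  simp only [← Complex.mul_conj', ← Complex.star_def, star_add, star_sub, star_mul', star_neg,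
    star_star, star_ofNat]
  linear_combination (a * star a + b * star b + 1) *
    (r * star r + 2 * (t * star t) + s * star s) * h

/-- The two-tangle of a two-qubit state of rank at most two. -/
theorem twoTangle_proj_add_proj (v w : Ket (Fin 2 × Fin 2))
    (ht : (proj v + proj w).trace = 1) :
    twoTangle (proj v + proj w) = ‖spinFlip v v‖ ^ 2 + 2 * ‖spinFlip v w‖ ^ 2
      + ‖spinFlip w w‖ ^ 2 - 2 * ‖spinFlip v v * spinFlip w w - spinFlip v w ^ 2‖ := by
  obtain ⟨a, b, hab, h0, hle⟩ := exists_takagi (spinFlip v v) (spinFlip v w) (spinFlip w w)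
  have hwv : spinFlip w v = spinFlip v w := spinFlip_comm w v
  have hρ := proj_add_proj_rotate a b hab v w
  set x := a • v + b • w with hx
  set y := (-star b) • v + star a • w with hy
  have exx : spinFlip x x = a * a * spinFlip v v + 2 * a * b * spinFlip v w
      + b * b * spinFlip w w := by
    simp only [hx, spinFlip_comb_left, spinFlip_comb_right, hwv]; ring
  have exy : spinFlip x y = a * (-star b) * spinFlip v v
      + (a * star a - b * star b) * spinFlip v w + b * star a * spinFlip w w := by
    simp only [hx, hy, spinFlip_comb_left, spinFlip_comb_right, hwv]; ring
  have eyy : spinFlip y y = star b * star b * spinFlip v v - 2 * star a * star b * spinFlip v w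
      + star a * star a * spinFlip w w := by
    simp only [hy, spinFlip_comb_left, spinFlip_comb_right, hwv]; ring
  have hdet : spinFlip x x * spinFlip y y - spinFlip x y ^ 2
      = spinFlip v v * spinFlip w w - spinFlip v w ^ 2 := by
    rw [exx, exy, eyy]
    -- The change of ensemble has determinant N = |a|² + |b|², which enters squared; N² - 1 = (N +
    -- 1)(N - 1).
    linear_combination (a * star a + b * star b + 1) *
      (spinFlip v v * spinFlip w w - spinFlip v w ^ 2) * hab
  have hfrob := takagi_frobenius a b (spinFlip v v) (spinFlip v w) (spinFlip w w) hab
  rw [← exx, ← exy, ← eyy] at hfrob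
  rw [← exy] at h0
  rw [← exx, ← eyy] at hle
  -- Expanding (λ₁ - λ₂)² leaves only the two invariants, Frobenius norm and determinant.
  rw [← hρ, twoTangle_of_spinFlip_eq_zero x y (by rw [hρ, ht]) h0 hle, ← hdet, ← hfrob, h0,
    zero_pow two_ne_zero, sub_zero, norm_mul, norm_zero]
  ring

/-! ### Trace identities for the marginals -/

/-- Reduced density matrix of qubit `C`. -/
def rhoC (ψ : Ket3) : Matrix (Fin 2) (Fin 2) ℂ := traceFst (rhoBC ψ)

/-- Complementary marginals of a pure state have the same nonzero spectrum. -/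
theorem trace_rhoAB_sq (ψ : Ket3) :
    Matrix.trace (rhoAB ψ ^ 2) = Matrix.trace (rhoC ψ ^ 2) := by
  simp only [pow_two, Matrix.trace, Matrix.diag, Matrix.mul_apply, rhoAB, rhoC, rhoBC, traceFst,
    Matrix.of_apply, Fintype.sum_prod_type, Fin.sum_univ_two, proj]
  ring

theorem rhoAB_trace_eq (ψ : Ket3) :
    (rhoAB ψ).trace = ((‖ψ‖ ^ 2 : ℝ) : ℂ) := by
  rw [← trace_proj, Matrix.trace, Matrix.trace]
  simp only [Matrix.diag]
  rw [sum_ket3 fun x => proj ψ x x]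
  simp [rhoAB, Fintype.sum_prod_type]

-- Powers of the trace make both sides homogeneous, so no normalization is needed.
set_option maxHeartbeats 8000000 in
theorem trace_phiMatrix_pow_three (ψ : Ket3) :
    Matrix.trace (phiMatrix ψ ^ 3) = -24 * (rhoAB ψ).trace ^ 3
      + 27 * (rhoAB ψ).trace * (Matrix.trace (rhoA ψ ^ 2) + Matrix.trace (rhoB ψ ^ 2)
        + Matrix.trace (rhoC ψ ^ 2))
      - 3 * (rhoAB ψ).trace * Matrix.trace (rhoC ψ ^ 2)
      + 12 * Matrix.trace (partialTranspose (rhoBC ψ) ^ 3) := by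
  simp only [pow_three, pow_two, Matrix.trace, Matrix.diag, Matrix.mul_apply, partialTranspose,
    phiMatrix, Matrix.add_apply, Matrix.smul_apply, Matrix.kronecker_apply,
    rhoAB, rhoBC, rhoA, rhoB, rhoC, traceFst, traceSnd,
    Matrix.of_apply, Fintype.sum_prod_type, Fin.sum_univ_two, proj, Matrix.one_apply, smul_eq_mul]
  simp only [if_true, if_false, zero_ne_one, one_ne_zero, mul_one, mul_zero, zero_mul, one_mul,
    add_zero]
  generalize ψ ![0,0,0] = x0
  generalize ψ ![0,0,1] = x1
  generalize ψ ![0,1,0] = x2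
  generalize ψ ![0,1,1] = x3
  generalize ψ ![1,0,0] = x4
  generalize ψ ![1,0,1] = x5
  generalize ψ ![1,1,0] = x6
  generalize ψ ![1,1,1] = x7
  -- The identity holds with the conjugates as independent variables.
  generalize star x0 = y0
  generalize star x1 = y1
  generalize star x2 = y2
  generalize star x3 = y3
  generalize star x4 = y4
  generalize star x5 = y5
  generalize star x6 = y6
  generalize star x7 = y7
  ring

/-! ### Two-tangles, purities and the hyperdeterminant -/

/-- The unnormalized state of `A`, `B` after finding `C` in the basis state `c`. -/
def ketAB (ψ : Ket3) (c : Fin 2) : Ket (Fin 2 × Fin 2) := WithLp.toLp 2 fun x => ψ ![x.1, x.2, c]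

/-- The unnormalized state of `A`, `C` after finding `B` in the basis state `b`. -/
def ketAC (ψ : Ket3) (b : Fin 2) : Ket (Fin 2 × Fin 2) := WithLp.toLp 2 fun x => ψ ![x.1, b, x.2]

/-- The unnormalized state of `B`, `C` after finding `A` in the basis state `a`. -/
def ketBC (ψ : Ket3) (a : Fin 2) : Ket (Fin 2 × Fin 2) := WithLp.toLp 2 fun x => ψ ![a, x.1, x.2]

theorem rhoAB_eq (ψ : Ket3) : rhoAB ψ = proj (ketAB ψ 0) + proj (ketAB ψ 1) := by
  ext x y
  simp [rhoAB, proj, ketAB, Fin.sum_univ_two]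

theorem rhoAC_eq (ψ : Ket3) : rhoAC ψ = proj (ketAC ψ 0) + proj (ketAC ψ 1) := by
  ext x y
  simp [rhoAC, proj, ketAC, Fin.sum_univ_two]

theorem rhoBC_eq (ψ : Ket3) : rhoBC ψ = proj (ketBC ψ 0) + proj (ketBC ψ 1) := by
  ext x y
  simp [rhoBC, proj, ketBC, Fin.sum_univ_two]

/-- The determinant of the spin-flip form on a pair of vectors. -/
def spinFlipDet (v : Fin 2 → Ket (Fin 2 × Fin 2)) : ℂ :=
  spinFlip (v 0) (v 0) * spinFlip (v 1) (v 1) - spinFlip (v 0) (v 1) ^ 2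

/-- The squared Frobenius norm of the spin-flip form on a pair of vectors. -/
noncomputable def spinFlipNormSq (v : Fin 2 → Ket (Fin 2 × Fin 2)) : ℝ :=
  ‖spinFlip (v 0) (v 0)‖ ^ 2 + 2 * ‖spinFlip (v 0) (v 1)‖ ^ 2 + ‖spinFlip (v 1) (v 1)‖ ^ 2

theorem spinFlipDet_ketAC (ψ : Ket3) : spinFlipDet (ketAC ψ) = spinFlipDet (ketAB ψ) := by
  simp only [spinFlipDet, spinFlip, ketAC, ketAB]
  ring

theorem spinFlipDet_ketBC (ψ : Ket3) : spinFlipDet (ketBC ψ) = spinFlipDet (ketAB ψ) := by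
  simp only [spinFlipDet, spinFlip, ketBC, ketAB]
  ring

theorem tauAB_eq (ψ : Ket3) (h : ‖ψ‖ = 1) :
    tauAB ψ = spinFlipNormSq (ketAB ψ) - 2 * ‖spinFlipDet (ketAB ψ)‖ := by
  have ht := rhoAB_trace ψ h
  rw [rhoAB_eq] at ht
  rw [tauAB, rhoAB_eq, twoTangle_proj_add_proj _ _ ht, spinFlipNormSq, spinFlipDet]

theorem tauAC_eq (ψ : Ket3) (h : ‖ψ‖ = 1) :
    tauAC ψ = spinFlipNormSq (ketAC ψ) - 2 * ‖spinFlipDet (ketAB ψ)‖ := by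
  have ht := rhoAC_trace ψ h
  rw [rhoAC_eq] at ht
  rw [tauAC, rhoAC_eq, twoTangle_proj_add_proj _ _ ht, spinFlipNormSq, ← spinFlipDet_ketAC,
    spinFlipDet]

theorem tauBC_eq (ψ : Ket3) (h : ‖ψ‖ = 1) :
    tauBC ψ = spinFlipNormSq (ketBC ψ) - 2 * ‖spinFlipDet (ketAB ψ)‖ := by
  have ht := rhoBC_trace ψ h
  rw [rhoBC_eq] at ht
  rw [tauBC, rhoBC_eq, twoTangle_proj_add_proj _ _ ht, spinFlipNormSq, ← spinFlipDet_ketBC,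
    spinFlipDet]

theorem ofReal_spinFlipNormSq (v : Fin 2 → Ket (Fin 2 × Fin 2)) :
    (spinFlipNormSq v : ℂ) = spinFlip (v 0) (v 0) * star (spinFlip (v 0) (v 0))
      + 2 * (spinFlip (v 0) (v 1) * star (spinFlip (v 0) (v 1)))
      + spinFlip (v 1) (v 1) * star (spinFlip (v 1) (v 1)) := by
  simp only [Complex.star_def, Complex.mul_conj', spinFlipNormSq]
  push_cast
  rfl

/-- A polynomial identity once 1 is replaced by the squared trace. -/
theorem spinFlipNormSq_add_A (ψ : Ket3) (h : ‖ψ‖ = 1) :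
    spinFlipNormSq (ketAB ψ) + spinFlipNormSq (ketAC ψ)
      = 2 * (1 - (Matrix.trace (rhoA ψ ^ 2)).re) := by
  have key : ((spinFlipNormSq (ketAB ψ) + spinFlipNormSq (ketAC ψ) : ℝ) : ℂ)
      = 2 * ((rhoAB ψ).trace ^ 2 - Matrix.trace (rhoA ψ ^ 2)) := by
    rw [Complex.ofReal_add, ofReal_spinFlipNormSq, ofReal_spinFlipNormSq]
    simp only [pow_two, Matrix.trace, Matrix.diag, Matrix.mul_apply, rhoAB, rhoA, traceSnd,
      Matrix.of_apply, Fintype.sum_prod_type, Fin.sum_univ_two, proj, spinFlip, ketAB, ketAC,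
      star_add, star_sub, star_mul']
    ring
  rw [rhoAB_trace ψ h, one_pow] at key
  simpa using congrArg Complex.re key

theorem spinFlipNormSq_add_B (ψ : Ket3) (h : ‖ψ‖ = 1) :
    spinFlipNormSq (ketAB ψ) + spinFlipNormSq (ketBC ψ)
      = 2 * (1 - (Matrix.trace (rhoB ψ ^ 2)).re) := by
  have key : ((spinFlipNormSq (ketAB ψ) + spinFlipNormSq (ketBC ψ) : ℝ) : ℂ)
      = 2 * ((rhoAB ψ).trace ^ 2 - Matrix.trace (rhoB ψ ^ 2)) := by
    rw [Complex.ofReal_add, ofReal_spinFlipNormSq, ofReal_spinFlipNormSq]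
    simp only [pow_two, Matrix.trace, Matrix.diag, Matrix.mul_apply, rhoAB, rhoB, traceFst,
      Matrix.of_apply, Fintype.sum_prod_type, Fin.sum_univ_two, proj, spinFlip, ketAB, ketBC,
      star_add, star_sub, star_mul']
    ring
  rw [rhoAB_trace ψ h, one_pow] at key
  simpa using congrArg Complex.re key

theorem spinFlipNormSq_add_C (ψ : Ket3) (h : ‖ψ‖ = 1) :
    spinFlipNormSq (ketAC ψ) + spinFlipNormSq (ketBC ψ)
      = 2 * (1 - (Matrix.trace (rhoC ψ ^ 2)).re) := by
  have key : ((spinFlipNormSq (ketAC ψ) + spinFlipNormSq (ketBC ψ) : ℝ) : ℂ)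
      = 2 * ((rhoAB ψ).trace ^ 2 - Matrix.trace (rhoC ψ ^ 2)) := by
    rw [Complex.ofReal_add, ofReal_spinFlipNormSq, ofReal_spinFlipNormSq]
    simp only [pow_two, Matrix.trace, Matrix.diag, Matrix.mul_apply, rhoAB, rhoBC, rhoC, traceFst,
      Matrix.of_apply, Fintype.sum_prod_type, Fin.sum_univ_two, proj, spinFlip, ketAC, ketBC,
      star_add, star_sub, star_mul']
    ring
  rw [rhoAB_trace ψ h, one_pow] at key
  simpa using congrArg Complex.re key

/-- The sum of the purities of the three qubits. -/
noncomputable def puritySum (ψ : Ket3) : ℂ :=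
  Matrix.trace (rhoA ψ ^ 2) + Matrix.trace (rhoB ψ ^ 2) + Matrix.trace (rhoC ψ ^ 2)

theorem tau_sum_eq (ψ : Ket3) (h : ‖ψ‖ = 1) :
    tauAB ψ + tauAC ψ + tauBC ψ
      = 3 - (puritySum ψ).re - 6 * ‖spinFlipDet (ketAB ψ)‖ := by
  rw [tauAB_eq ψ h, tauAC_eq ψ h, tauBC_eq ψ h, puritySum, Complex.add_re, Complex.add_re]
  linear_combination (spinFlipNormSq_add_A ψ h + spinFlipNormSq_add_B ψ h
    + spinFlipNormSq_add_C ψ h) / 2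

/-- The three-tangle is four times the modulus of Cayley's hyperdeterminant. -/
theorem threeTangle_eq (ψ : Ket3) (h : ‖ψ‖ = 1) :
    threeTangle ψ = 4 * ‖spinFlipDet (ketAB ψ)‖ := by
  rw [threeTangle, tauA_BC, tauAB_eq ψ h, tauAC_eq ψ h]
  linear_combination -spinFlipNormSq_add_A ψ h

/-- The purity of `rhoAB` in `phiABC` is that of `rhoC`; it cancels the only term of the cubic trace
identity that is asymmetric in the purities. -/
theorem phiABC_eq_purity (ψ : Ket3) (h : ‖ψ‖ = 1) :
    phiABC ψ = 12 * (1 - I5 ψ) + 27 * (3 - (puritySum ψ).re) := by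
  have key := congrArg Complex.re (trace_phiMatrix_pow_three ψ)
  rw [← puritySum, rhoAB_trace ψ h] at key
  simp only [one_pow, mul_one, Complex.add_re, Complex.sub_re, Complex.mul_re, Complex.neg_re,
    Complex.re_ofNat, Complex.im_ofNat, zero_mul, sub_zero] at key
  rw [phiABC, trace_rhoAB_sq, key, I5]
  ring

theorem phiABC_eq (ψ : Ket3) (h : ‖ψ‖ = 1) :
    phiABC ψ = 12 * (1 - I5 ψ) + 27 * (tauAB ψ + tauAC ψ + tauBC ψ)
      + 81 / 2 * threeTangle ψ := by
  rw [phiABC_eq_purity ψ h, tau_sum_eq ψ h, threeTangle_eq ψ h]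
  ring

/-! ### Invariance under permutations of the qubits -/

theorem permuteQubits_mul (σ τ : Equiv.Perm (Fin 3)) (ψ : Ket3) :
    permuteQubits (σ * τ) ψ = permuteQubits σ (permuteQubits τ ψ) := rfl

theorem perm_fin_three_cases (σ : Equiv.Perm (Fin 3)) :
    σ = 1 ∨ σ = .swap 0 1 ∨ σ = .swap 1 2 ∨ σ = .swap 0 1 * .swap 1 2 ∨
      σ = .swap 1 2 * .swap 0 1 ∨ σ = .swap 0 1 * (.swap 1 2 * .swap 0 1) := by
  revert σ
  decide

/-- A function of three-qubit states invariant under adjacent swaps is invariant under all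
permutations of the qubits. -/
theorem eq_of_swap_invariant {α : Type} (F : Ket3 → α)
    (h01 : ∀ ψ, F (permuteQubits (.swap 0 1) ψ) = F ψ)
    (h12 : ∀ ψ, F (permuteQubits (.swap 1 2) ψ) = F ψ) (σ : Equiv.Perm (Fin 3)) (ψ : Ket3) :
    F (permuteQubits σ ψ) = F ψ := by
  rcases perm_fin_three_cases σ with rfl | rfl | rfl | rfl | rfl | rfl
  · rfl
  all_goals simp only [permuteQubits_mul, h01, h12]

theorem permuteQubits_swap_zero_one (ψ : Ket3) (a b c : Fin 2) :
    permuteQubits (.swap 0 1) ψ ![a, b, c] = ψ ![b, a, c] := by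
  have e : (fun i => ![a, b, c] (Equiv.swap 0 1 i)) = ![b, a, c] := by
    ext i
    fin_cases i <;> rfl
  exact congrArg ψ e

theorem permuteQubits_swap_one_two (ψ : Ket3) (a b c : Fin 2) :
    permuteQubits (.swap 1 2) ψ ![a, b, c] = ψ ![a, c, b] := by
  have e : (fun i => ![a, b, c] (Equiv.swap 1 2 i)) = ![a, c, b] := by
    ext i
    fin_cases i <;> rfl
  exact congrArg ψ e

/-- The squared norm is the trace of `rhoAB`, a polynomial to which the swap criterion applies. -/
theorem norm_permuteQubits (σ : Equiv.Perm (Fin 3)) (ψ : Ket3) : ‖permuteQubits σ ψ‖ = ‖ψ‖ := by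
  have h := eq_of_swap_invariant (fun ψ => (rhoAB ψ).trace)
    (fun ψ => by
      simp only [Matrix.trace, Matrix.diag, rhoAB, Matrix.of_apply, Fintype.sum_prod_type,
        Fin.sum_univ_two, proj, permuteQubits_swap_zero_one]
      ring)
    (fun ψ => by
      simp only [Matrix.trace, Matrix.diag, rhoAB, Matrix.of_apply, Fintype.sum_prod_type,
        Fin.sum_univ_two, proj, permuteQubits_swap_one_two]
      ring) σ ψ
  simp only [rhoAB_trace_eq, Complex.ofReal_inj] at h
  exact (sq_eq_sq₀ (norm_nonneg _) (norm_nonneg _)).mp h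

theorem spinFlipDet_permuteQubits (σ : Equiv.Perm (Fin 3)) (ψ : Ket3) :
    spinFlipDet (ketAB (permuteQubits σ ψ)) = spinFlipDet (ketAB ψ) := by
  refine eq_of_swap_invariant (fun ψ => spinFlipDet (ketAB ψ)) (fun ψ => ?_) (fun ψ => ?_) σ ψ
  · simp only [spinFlipDet, spinFlip, ketAB, permuteQubits_swap_zero_one]
    ring
  · simp only [spinFlipDet, spinFlip, ketAB, permuteQubits_swap_one_two]
    ring

theorem puritySum_permuteQubits (σ : Equiv.Perm (Fin 3)) (ψ : Ket3) :
    puritySum (permuteQubits σ ψ) = puritySum ψ := by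
  refine eq_of_swap_invariant puritySum (fun ψ => ?_) (fun ψ => ?_) σ ψ
  · simp only [puritySum, pow_two, Matrix.trace, Matrix.diag, Matrix.mul_apply, rhoAB, rhoBC, rhoA,
      rhoB, rhoC, traceFst, traceSnd, Matrix.of_apply, Fin.sum_univ_two, proj,
      permuteQubits_swap_zero_one]
    ring
  · simp only [puritySum, pow_two, Matrix.trace, Matrix.diag, Matrix.mul_apply, rhoAB, rhoBC, rhoA,
      rhoB, rhoC, traceFst, traceSnd, Matrix.of_apply, Fin.sum_univ_two, proj,
      permuteQubits_swap_one_two]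
    ring

set_option maxHeartbeats 4000000 in
theorem I5_permuteQubits (σ : Equiv.Perm (Fin 3)) (ψ : Ket3) :
    I5 (permuteQubits σ ψ) = I5 ψ := by
  refine eq_of_swap_invariant I5 (fun ψ => ?_) (fun ψ => ?_) σ ψ
  · rw [I5, I5]
    refine congrArg Complex.re ?_
    simp only [pow_three, Matrix.trace, Matrix.diag, Matrix.mul_apply, partialTranspose, rhoBC,
      Matrix.of_apply, Fintype.sum_prod_type, Fin.sum_univ_two, proj, permuteQubits_swap_zero_one]
    generalize ψ ![0, 0, 0] = x0
    generalize ψ ![0, 0, 1] = x1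
    generalize ψ ![0, 1, 0] = x2
    generalize ψ ![0, 1, 1] = x3
    generalize ψ ![1, 0, 0] = x4
    generalize ψ ![1, 0, 1] = x5
    generalize ψ ![1, 1, 0] = x6
    generalize ψ ![1, 1, 1] = x7
    generalize star x0 = y0
    generalize star x1 = y1
    generalize star x2 = y2
    generalize star x3 = y3
    generalize star x4 = y4
    generalize star x5 = y5
    generalize star x6 = y6
    generalize star x7 = y7
    ring
  · rw [I5, I5]
    refine congrArg Complex.re ?_
    simp only [pow_three, Matrix.trace, Matrix.diag, Matrix.mul_apply, partialTranspose, rhoBC,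
      Matrix.of_apply, Fintype.sum_prod_type, Fin.sum_univ_two, proj, permuteQubits_swap_one_two]
    generalize ψ ![0, 0, 0] = x0
    generalize ψ ![0, 0, 1] = x1
    generalize ψ ![0, 1, 0] = x2
    generalize ψ ![0, 1, 1] = x3
    generalize ψ ![1, 0, 0] = x4
    generalize ψ ![1, 0, 1] = x5
    generalize ψ ![1, 1, 0] = x6
    generalize ψ ![1, 1, 1] = x7
    generalize star x0 = y0
    generalize star x1 = y1
    generalize star x2 = y2
    generalize star x3 = y3
    generalize star x4 = y4
    generalize star x5 = y5
    generalize star x6 = y6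
    generalize star x7 = y7
    ring

end ThreeQubit

theorem mainTheorem10 (ψ : ThreeQubit.Ket3) (hψ : ‖ψ‖ = 1) :
    ThreeQubit.phiABC ψ =
        12 * (1 - ThreeQubit.I5 ψ)
          + 27 * (ThreeQubit.tauAB ψ + ThreeQubit.tauAC ψ + ThreeQubit.tauBC ψ)
          + 81 / 2 * ThreeQubit.threeTangle ψ ∧
      ∀ σ : Equiv.Perm (Fin 3),
        ThreeQubit.phiABC (ThreeQubit.permuteQubits σ ψ) = ThreeQubit.phiABC ψ ∧
        ThreeQubit.I5 (ThreeQubit.permuteQubits σ ψ) = ThreeQubit.I5 ψ ∧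
        ThreeQubit.tauAB (ThreeQubit.permuteQubits σ ψ)
            + ThreeQubit.tauAC (ThreeQubit.permuteQubits σ ψ)
            + ThreeQubit.tauBC (ThreeQubit.permuteQubits σ ψ) =
          ThreeQubit.tauAB ψ + ThreeQubit.tauAC ψ + ThreeQubit.tauBC ψ ∧
        ThreeQubit.threeTangle (ThreeQubit.permuteQubits σ ψ) = ThreeQubit.threeTangle ψ := by
  refine ⟨ThreeQubit.phiABC_eq ψ hψ, fun σ => ?_⟩
  have h : ‖ThreeQubit.permuteQubits σ ψ‖ = 1 := by rw [ThreeQubit.norm_permuteQubits, hψ]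
  refine ⟨?_, ThreeQubit.I5_permuteQubits σ ψ, ?_, ?_⟩
  · rw [ThreeQubit.phiABC_eq_purity _ h, ThreeQubit.phiABC_eq_purity ψ hψ,
      ThreeQubit.I5_permuteQubits, ThreeQubit.puritySum_permuteQubits]
  · rw [ThreeQubit.tau_sum_eq _ h, ThreeQubit.tau_sum_eq ψ hψ,
      ThreeQubit.puritySum_permuteQubits, ThreeQubit.spinFlipDet_permuteQubits]
  · rw [ThreeQubit.threeTangle_eq _ h, ThreeQubit.threeTangle_eq ψ hψ,
      ThreeQubit.spinFlipDet_permuteQubits]
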